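/- Let $d$ be a prime and let $G=(V,E)$ be a finite non-empty directed graph without loops or multiple edges, with one $d$-level qudit (standard basis $|a\rangle$, $a\in\mathbb Z_d$) at each vertex. *Linear network code.* Let $t_1,\dots,t_N\in V$ be distinct transmitters, each of in-degree $0$ in $G$, and let $R_j=\{r_{j,1},\dots,r_{j,n_j}\}\subseteq V$ $(1\le j\le N)$ be pairwise disjoint sets of receivers, containing no transmitter, each receiver having out-degree $0$ in $G$ (multiple unicast is the case $n_j=1$ for all $j$; $n_j=0$ is allowed). A $\mathbb Z_d$ linear network code for this multiple multicast task assigns a coefficient $c_{uv}\in\mathbb Z_d$ to every edge $u\to v$ of $G$, such that the edges with non-zero coefficient form no directed cycle. Given $a\in\mathbb Z_d^N$, every vertex broadcasts one message: $m(t_j)=a_j$, and $m(v)=\sum_{u\to v}c_{uv}\,m(u)$ for every vertex $v$ that is not a transmitter. It is required that $m(r)=a_j$ for all $a$, all $j$ and all $r\in R_j$. *Qudit QLNC circuits.* With $\omega=e^{2\pi i/d}$, let $X_d|a\rangle=|a+1\rangle$, $Z_d|a\rangle=\omega^a|a\rangle$, $\mathrm{Add}_d|x\rangle|y\rangle=|x\rangle|y+x\rangle$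 (modulo $d$). A qudit QLNC circuit on $G$ consists of a first time-step in which every qudit is prepared in $|0\rangle$ or in $|+_d\rangle=\frac1{\sqrt d}\sum_a|a\rangle$, followed by finitely many time-steps, each consisting of operations on pairwise disjoint sets of qudits. The allowed operations are: a gate $X_d$ or $Z_d$ on a qudit, possibly conditioned on an arbitrary function of the outcomes of measurements in earlier time-steps; a measurement of a qudit in the eigenbasis of $X_d$ or of $Z_d$; a gate $\mathrm{Add}_d$ with control $u$ and target $v$ for an edge $u\to v$ of $G$. The depth is the number of time-steps, including the preparation; classical computation is not counted. *States.* Let $|\mathrm{GHZ}_{d,n}\rangle=\frac1{\sqrt d}\sum_{a\in\mathbb Z_d}|a\rangle^{\otimes n}$, so that $|\mathrm{GHZ}_{d,2}\rangle=|\Phi_d^+\rangle$. **Statement.** If a $\mathbb Z_d$ linear network code for the task exists, then there is a qudit QLNC circuit on $G$ such that, whatever the measurement outcomes, its final state is, up to a global phase, the tensor product of the states $|\mathrm{GHZ}_{d,n_j+1}\rangle$ on the sets $\{t_j,r_{j,1},\dots,r_{j,n_j}\}$, $1\le j\le N$, and of some state of the remaining qudits. (In particular, it is $|\Phi_d^+\rangle$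 on $\{t_j,r_{j,1}\}$ when $n_j=1$.) Moreover the depth of the circuit is at most $$2(d-1)\bigl[(\delta+2)(\chi-1)+1\bigr],$$ where $\delta$ is the largest in-degree or out-degree of a vertex of $G$, and $\chi$ is the chromatic number of the undirected graph underlying $G$. -/

import Mathlib

namespace QLNC

/-! ### Networks -/

/-- The largest in-degree or out-degree of a vertex of the directed graph `G`. -/
noncomputable def maxInOutDegree {V : Type*} [Fintype V] (G : Digraph V) : ℕ :=
  Finset.univ.sup fun v : V => max {u | G.Adj u v}.ncard {w | G.Adj v w}.ncard

/-- A multiple multicast task on `G` with `N` streams: stream `j` is to be sent from the transmitter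
`t j` to all nodes of the receiver set `R j`. Transmitters have in-degree `0`, receivers have
out-degree `0`. (Multiple unicast is the case where every `R j` has one element.) -/
structure Multicast {V : Type*} (G : Digraph V) (N : ℕ) where
  t : Fin N → V
  R : Fin N → Finset V
  t_injective : Function.Injective t
  R_disjoint : ∀ i j, i ≠ j → Disjoint (R i) (R j)
  t_notMem_R : ∀ i j, t i ∉ R j
  t_in_degree : ∀ j u, ¬ G.Adj u (t j)
  R_out_degree : ∀ j, ∀ r ∈ R j, ∀ w, ¬ G.Adj r w

/-- A `ℤ_d` linear network code for the task `P`. Every node `v` has, for each tuple `a` of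
transmitted values, one message `msg a v`, which it broadcasts on all its outgoing edges: a
transmitter sends its own value, and every other node computes the linear combination of its
incoming messages with the coefficients `coeff u v` on the edges `u → v`. No directed cycle of
edges is used, so that the messages can be computed one after the other. Each receiver obtains
the value of its transmitter. -/
structure LinearCode {V : Type*} [Fintype V] {G : Digraph V} {N : ℕ} (P : Multicast G N)
    (d : ℕ) where
  coeff : V → V → ZMod d
  adj_of_coeff_ne_zero : ∀ u v, coeff u v ≠ 0 → G.Adj u v
  acyclic : ∀ v, ¬ Relation.TransGen (fun u w => coeff u w ≠ 0) v v
  msg : (Fin N → ZMod d) → V → ZMod d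
  msg_transmitter : ∀ a j, msg a (P.t j) = a j
  msg_other : ∀ a v, v ∉ Set.range P.t → msg a v = ∑ u, coeff u v * msg a u
  msg_receiver : ∀ a j, ∀ r ∈ P.R j, msg a r = a j

/-! ### Qudit QLNC circuits -/

/-- Vectors of the Hilbert space of one `d`-level qudit at each node of `V`, given by their
amplitudes in the standard basis `|x⟩`, `x : V → ℤ_d`. -/
abbrev State (V : Type*) (d : ℕ) := (V → ZMod d) → ℂ

/-- The classical record of past time steps (oldest first): for each time step, the outcome at every
qudit measured in it, and `none` at the other qudits. -/
abbrev History (V : Type*) (d : ℕ) := List (V → Option (ZMod d))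

/-- The elementary operations after preparation: `X_d` and `Z_d` gates, performed if the past
measurement outcomes satisfy a condition; measurements in the eigenbasis of `X_d` or `Z_d`;
and the gate `Add_d` with control `u` and target `v`, along an edge `u → v` of `G`. -/
inductive Op {V : Type*} (G : Digraph V) (d : ℕ) where
  | gateX (q : V) (cond : History V d → Bool)
  | gateZ (q : V) (cond : History V d → Bool)
  | measX (q : V)
  | measZ (q : V)
  | add (u v : V) (hne : u ≠ v) (hadj : G.Adj u v)

variable {V : Type*} [DecidableEq V] {d : ℕ}

/-- The qudits on which an operation acts. -/
def Op.support {G : Digraph V} : Op G d → Finset V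
  | .gateX q _ => {q}
  | .gateZ q _ => {q}
  | .measX q => {q}
  | .measZ q => {q}
  | .add u v _ _ => {u, v}

/-- `X_d |a⟩ = |a + 1⟩` on the qudit `q`. -/
def applyX (q : V) (ψ : State V d) : State V d :=
  fun x => ψ (Function.update x q (x q - 1))

/-- `Z_d |a⟩ = ω ^ a |a⟩` on the qudit `q`, where `ω = exp (2 π i / d)`. -/
noncomputable def applyZ [NeZero d] (q : V) (ψ : State V d) : State V d :=
  fun x => ZMod.stdAddChar (x q) * ψ x

/-- `Add_d |x⟩ |y⟩ = |x⟩ |y + x⟩` with control `u` and target `v`. -/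
def applyAdd (u v : V) (ψ : State V d) : State V d :=
  fun x => ψ (Function.update x v (x v - x u))

/-- The projection onto the eigenspace of `Z_d` on the qudit `q` for the eigenvalue `ω ^ s`. -/
def projZ (q : V) (s : ZMod d) (ψ : State V d) : State V d :=
  fun x => if x q = s then ψ x else 0

/-- The projection `(1 / d) ∑ₖ ω ^ (- s k) X_d ^ k` onto the eigenspace of `X_d` on the qudit `q`
for the eigenvalue `ω ^ s`. -/
noncomputable def projX [NeZero d] (q : V) (s : ZMod d) (ψ : State V d) : State V d :=
  fun x => (d : ℂ)⁻¹ *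
    ∑ k : ZMod d, ZMod.stdAddChar (-(s * k)) * ψ (Function.update x q (x q - k))

/-- The effect of an operation on an (unnormalised) state, given the record `h` of the earlier time
steps and, if it is a measurement of the qudit `q`, its outcome `o q`. -/
noncomputable def Op.apply [NeZero d] {G : Digraph V} (h : History V d) (o : V → ZMod d) :
    Op G d → State V d → State V d
  | .gateX q cond, ψ => if cond h then applyX q ψ else ψ
  | .gateZ q cond, ψ => if cond h then applyZ q ψ else ψ
  | .measX q, ψ => projX q (o q) ψ
  | .measZ q, ψ => projZ q (o q) ψ
  | .add u v _ _, ψ => applyAdd u v ψ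

/-- A time step: operations which act on pairwise disjoint sets of qudits. -/
structure Layer (G : Digraph V) (d : ℕ) where
  ops : List (Op G d)
  disjoint : ops.Pairwise fun a b => Disjoint a.support b.support

/-- The effect of a time step. (The operations commute, so that their order is immaterial.) -/
noncomputable def Layer.apply [NeZero d] {G : Digraph V} (L : Layer G d) (h : History V d)
    (o : V → ZMod d) (ψ : State V d) : State V d :=
  L.ops.foldl (fun φ op => op.apply h o φ) ψ

open Classical in
/-- What a time step adds to the classical record. -/
noncomputable def Layer.record {G : Digraph V} (L : Layer G d) (o : V → ZMod d) :
    V → Option (ZMod d) :=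
  fun q => if Op.measX q ∈ L.ops ∨ Op.measZ q ∈ L.ops then some (o q) else none

/-- The states in which a qudit may be prepared: `|0⟩` and `|+_d⟩`. -/
inductive Prep where
  | zero
  | plus

/-- The amplitudes of `|0⟩` and of `|+_d⟩ = d ^ (-1/2) (|0⟩ + ⋯ + |d - 1⟩)`. -/
noncomputable def Prep.amplitude (d : ℕ) : Prep → ZMod d → ℂ
  | .zero, a => if a = 0 then 1 else 0
  | .plus, _ => ((√(d : ℝ) : ℝ) : ℂ)⁻¹

/-- A qudit QLNC circuit on the network `G`, with one qudit at each node: a first time step in which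
each qudit is prepared in `|0⟩` or `|+_d⟩`, followed by further time steps. -/
structure Circuit (G : Digraph V) (d : ℕ) where
  init : V → Prep
  layers : List (Layer G d)

/-- The number of time steps, including the preparation. -/
def Circuit.depth {G : Digraph V} (Q : Circuit G d) : ℕ := 1 + Q.layers.length

/-- Run the given time steps when `h` is the record of those already done; the outcome of a
measurement of `q` in the time step number `k` (counted from `0`) is `o k q`. -/
noncomputable def run [NeZero d] {G : Digraph V} (o : ℕ → V → ZMod d) :
    List (Layer G d) → History V d → State V d → State V d
  | [], _, ψ => ψ
  | L :: Ls, h, ψ =>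
      run o Ls (h ++ [L.record (o h.length)]) (L.apply h (o h.length) ψ)

/-- The final state of the circuit if the measurement outcomes are as prescribed by `o`. It is not
renormalised after measurements: its squared norm is the probability of these outcomes. -/
noncomputable def Circuit.final [NeZero d] [Fintype V] {G : Digraph V} (Q : Circuit G d)
    (o : ℕ → V → ZMod d) : State V d :=
  run o Q.layers [] fun x => ∏ q, (Q.init q).amplitude d (x q)

/-! ### Entanglement distribution -/

/-- The amplitude at `|x⟩` of the state `GHZ_{d,n} = d ^ (-1/2) ∑ₐ |a⟩ |a⟩ ⋯ |a⟩` of the `n` qudits of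
the set `S`. For `n = 2` this is `|Φ_d⁺⟩`. -/
noncomputable def ghz [NeZero d] (S : Finset V) (x : V → ZMod d) : ℂ :=
  ((√(d : ℝ) : ℝ) : ℂ)⁻¹ * ∑ a : ZMod d, ∏ q ∈ S, if x q = a then 1 else 0

/-- The nodes which are to share the `j`-th state: the transmitter and its receivers. -/
def Multicast.party {G : Digraph V} {N : ℕ} (P : Multicast G N) (j : Fin N) : Finset V :=
  insert (P.t j) (P.R j)

/-- The circuit distributes `GHZ` states as asked for by `P`: whatever the measurement outcomes,
the final state is the tensor product of the `GHZ` states on the sets `P.party j` with some state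
`φ` of the remaining qudits. (Outcomes of probability zero satisfy this with `φ = 0`.) -/
def Circuit.Distributes [NeZero d] [Fintype V] {G : Digraph V} {N : ℕ} (Q : Circuit G d)
    (P : Multicast G N) : Prop :=
  ∀ o : ℕ → V → ZMod d, ∃ φ : ({q : V // ∀ j, q ∉ P.party j} → ZMod d) → ℂ,
    ∀ x : V → ZMod d, Q.final o x = (∏ j, ghz (P.party j) x) * φ fun q => x q

end QLNC

/-! Let A be the coefficient matrix of the code. The circuit creates a uniform superposition over
the solutions y of y - yA = w, with w free at the transmitters and fixed by measurement outcomes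
elsewhere. As the code is acyclic, y is an affine function of the transmitter values
(`exists_linear_inverse`), and its linear part is the message of the code, so each receiver holds
its transmitter's value plus a known constant. Measuring all other qudits in the X basis leaves a
phase that is linear in the transmitter values, and Pauli corrections then give the GHZ states
(`exists_corrections_after_measX`).

The constraints are imposed by colour classes, not in the order of computation, so the depth does
not depend on the length of paths. A node starts in the plus state; its incoming combination is
subtracted, a Z measurement fixes the difference, and the combination is added back. Messages into
one class come from other classes, so these additions commute. By Kőnig's theorem the edges split
into δ matchings, each used up to d - 1 times, whence δ(d - 1) steps per pass
(`exists_layers_shear`). The induction over colours is `exists_layers_satisfies`, with invariant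
`Satisfies`.

Colour 0 needs no measurement: there the zero state already is a difference with outcome 0.
Receivers send nothing, so those of other colours start at zero and merely accumulate. The last
class is never restored, since it then contains no transmitter or receiver. This leaves χ - 1 rounds
of 2δ(d - 1) + 1 steps, besides preparation, X measurement and 2(d - 1) steps of corrections. -/

namespace QLNC

/-! ### Edge colourings of bipartite graphs -/

section EdgeColouring

variable {V : Type*} [Fintype V] [DecidableEq V]

/-- A non-negative integer matrix with constant positive row and column sums has a permutation in
its support. -/
theorem exists_perm_support_of_regular {k : ℕ} (M : V → V → ℕ)
    (hr : ∀ u, ∑ v, M u v = k + 1) (hc : ∀ v, ∑ u, M u v = k + 1) :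
    ∃ π : Equiv.Perm V, ∀ u, M u (π u) ≠ 0 := by
  -- Hall's condition by double counting: the rows in `s` have total weight `s.card * (k + 1)`, all
  -- of it in the columns `B`, whose total weight is `B.card * (k + 1)`.
  obtain ⟨f, hf, hfM⟩ := (Finset.all_card_le_biUnion_card_iff_exists_injective
    (fun u => Finset.univ.filter fun v => M u v ≠ 0)).1 fun s => by
      set B := s.biUnion fun u => Finset.univ.filter fun v => M u v ≠ 0 with hB
      have h : s.card * (k + 1) ≤ B.card * (k + 1) := calc
        s.card * (k + 1) = ∑ u ∈ s, ∑ v, M u v := by simp [hr]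
        _ = ∑ u ∈ s, ∑ v ∈ B, M u v := by
          refine Finset.sum_congr rfl fun u hu => (Finset.sum_subset (Finset.subset_univ _) ?_).symm
          intro v _ hv
          by_contra h0
          exact hv (Finset.mem_biUnion.2 ⟨u, hu, by simpa using h0⟩)
        _ = ∑ v ∈ B, ∑ u ∈ s, M u v := Finset.sum_comm
        _ ≤ ∑ v ∈ B, ∑ u, M u v :=
          Finset.sum_le_sum fun v _ => Finset.sum_le_sum_of_subset (Finset.subset_univ _)
        _ = B.card * (k + 1) := by simp [hc]
      exact Nat.le_of_mul_le_mul_right h (Nat.succ_pos k)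
  refine ⟨Equiv.ofBijective f (Finite.injective_iff_bijective.1 hf), fun u => ?_⟩
  simpa using hfM u

/-- A non-negative integer matrix with all row and column sums equal to `k` is covered by `k`
permutations. -/
theorem exists_perms_cover_of_regular {k : ℕ} : ∀ M : V → V → ℕ,
    (∀ u, ∑ v, M u v = k) → (∀ v, ∑ u, M u v = k) →
    ∃ π : ℕ → Equiv.Perm V, ∀ u v, M u v ≠ 0 → ∃ i < k, π i u = v := by
  induction k with
  | zero =>
    intro M hr _
    refine ⟨fun _ => 1, fun u v h => absurd ?_ h⟩
    exact (Finset.sum_eq_zero_iff.1 (hr u)) v (Finset.mem_univ v)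
  | succ k ih =>
    intro M hr hc
    obtain ⟨ρ, hρ⟩ := exists_perm_support_of_regular M hr hc
    have hM : ∀ u v, (M u v - if ρ u = v then 1 else 0) + (if ρ u = v then 1 else 0) = M u v := by
      intro u v
      split_ifs with h
      · exact Nat.sub_add_cancel (Nat.one_le_iff_ne_zero.2 (h ▸ hρ u))
      · rfl
    obtain ⟨π, hπ⟩ := ih (fun u v => M u v - if ρ u = v then 1 else 0)
      (fun u => by
        have h := hr u
        rw [← Finset.sum_congr rfl fun v _ => hM u v, Finset.sum_add_distrib] at h
        simpa using h)
      (fun v => by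
        have h := hc v
        rw [← Finset.sum_congr rfl fun u _ => hM u v, Finset.sum_add_distrib] at h
        have h1 : ∑ u, (if ρ u = v then 1 else 0) = 1 := by
          simp [← Equiv.eq_symm_apply]
        rw [h1] at h
        simpa using h)
    refine ⟨fun i => if i = k then ρ else π i, fun u v huv => ?_⟩
    by_cases h : ρ u = v
    · exact ⟨k, Nat.lt_succ_self k, by simpa using h⟩
    · obtain ⟨i, hi, hiv⟩ := hπ u v (by simpa [h] using huv)
      exact ⟨i, hi.trans (Nat.lt_succ_self k), by simpa [hi.ne] using hiv⟩

/-- A non-negative integer matrix with row and column sums at most `k` lies below one with all these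
sums equal to `k`. -/
theorem exists_regular_of_sum_le {k : ℕ} (n : ℕ) : ∀ M : V → V → ℕ,
    (∀ u, ∑ v, M u v ≤ k) → (∀ v, ∑ u, M u v ≤ k) →
    Fintype.card V * k = (∑ u, ∑ v, M u v) + n →
    ∃ M' : V → V → ℕ, (∀ u v, M u v ≤ M' u v) ∧ (∀ u, ∑ v, M' u v = k) ∧
      ∀ v, ∑ u, M' u v = k := by
  induction n with
  | zero =>
    intro M hr hc hn
    refine ⟨M, fun _ _ => le_rfl, fun u => ?_, fun v => ?_⟩
    · refine (Finset.sum_eq_sum_iff_of_le fun u _ => hr u).1 ?_ u (Finset.mem_univ u)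
      simpa using hn.symm
    · refine (Finset.sum_eq_sum_iff_of_le fun v _ => hc v).1 ?_ v (Finset.mem_univ v)
      rw [Finset.sum_comm]
      simpa using hn.symm
  | succ n ih =>
    intro M hr hc hn
    -- The number `n` is the total deficit. While it is positive, some row `a` and some column `b`
    -- are both below `k`, and the entry there is raised by one, even if it is already positive.
    obtain ⟨a, -, ha⟩ : ∃ a ∈ (Finset.univ : Finset V), ∑ v, M a v < k := by
      refine Finset.exists_lt_of_sum_lt ?_
      simp only [Finset.sum_const, Finset.card_univ, smul_eq_mul]
      omega
    obtain ⟨b, -, hb⟩ : ∃ b ∈ (Finset.univ : Finset V), ∑ u, M u b < k := by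
      refine Finset.exists_lt_of_sum_lt ?_
      rw [Finset.sum_comm]
      simp only [Finset.sum_const, Finset.card_univ, smul_eq_mul]
      omega
    have hrow : ∀ u, ∑ v, (M u v + if u = a ∧ v = b then 1 else 0) =
        (∑ v, M u v) + if u = a then 1 else 0 := by
      intro u
      rw [Finset.sum_add_distrib]
      by_cases h : u = a <;> simp [h]
    have hcol : ∀ v, ∑ u, (M u v + if u = a ∧ v = b then 1 else 0) =
        (∑ u, M u v) + if v = b then 1 else 0 := by
      intro v
      rw [Finset.sum_add_distrib]
      by_cases h : v = b <;> simp [h]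
    obtain ⟨M', hle, h⟩ := ih (fun u v => M u v + if u = a ∧ v = b then 1 else 0)
      (fun u => by
        rw [hrow]
        split_ifs with h
        · subst h; exact ha
        · exact hr u)
      (fun v => by
        rw [hcol]
        split_ifs with h
        · subst h; exact hb
        · exact hc v)
      (by
        simp_rw [hrow, Finset.sum_add_distrib]
        simp only [Finset.sum_ite_eq', Finset.mem_univ, if_true]
        omega)
    exact ⟨M', fun u v => (Nat.le_add_right _ _).trans (hle u v), h⟩

/-- The edges of a directed graph can be distributed among as many permutations of its vertices as
its largest in-degree or out-degree (König's edge colouring theorem). -/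
theorem exists_perms_cover_adj (G : Digraph V) :
    ∃ π : ℕ → Equiv.Perm V, ∀ u v, G.Adj u v → ∃ i < maxInOutDegree G, π i u = v := by
  classical
  have hle : ∀ v : V, max {u | G.Adj u v}.ncard {w | G.Adj v w}.ncard ≤ maxInOutDegree G :=
    fun v => Finset.le_sup (f := fun v : V => max {u | G.Adj u v}.ncard {w | G.Adj v w}.ncard)
      (Finset.mem_univ v)
  set M : V → V → ℕ := fun u v => if G.Adj u v then 1 else 0 with hM
  have hr : ∀ u, ∑ v, M u v ≤ maxInOutDegree G := fun u => by
    refine le_trans (le_of_eq ?_) ((le_max_right _ _).trans (hle u))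
    simp [hM, Set.ncard_eq_toFinset_card']
  have hc : ∀ v, ∑ u, M u v ≤ maxInOutDegree G := fun v => by
    refine le_trans (le_of_eq ?_) ((le_max_left _ _).trans (hle v))
    simp [hM, Set.ncard_eq_toFinset_card']
  have hn : (∑ u, ∑ v, M u v) ≤ Fintype.card V * maxInOutDegree G := by
    simpa using Finset.sum_le_sum fun u (_ : u ∈ Finset.univ) => hr u
  obtain ⟨n, hn⟩ := Nat.exists_eq_add_of_le hn
  obtain ⟨M', hMM', hr', hc'⟩ := exists_regular_of_sum_le n M hr hc hn
  obtain ⟨π, hπ⟩ := exists_perms_cover_of_regular M' hr' hc'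
  refine ⟨π, fun u v huv => hπ u v ?_⟩
  have := hMM' u v
  simp only [hM, huv, if_true] at this
  omega

end EdgeColouring

/-! ### Running circuits -/

section Running

variable {V : Type*} [DecidableEq V] {d : ℕ} {G : Digraph V}

/-- The classical record after the given time steps, when `h` is the record before them. -/
noncomputable def recordAfter (o : ℕ → V → ZMod d) : List (Layer G d) → History V d → History V d
  | [], h => h
  | L :: Ls, h => recordAfter o Ls (h ++ [L.record (o h.length)])

theorem length_recordAfter (o : ℕ → V → ZMod d) (Ls : List (Layer G d)) (h : History V d) :
    (recordAfter o Ls h).length = h.length + Ls.length := by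
  induction Ls generalizing h with
  | nil => rfl
  | cons L Ls ih => simp [recordAfter, ih]; omega

theorem prefix_recordAfter (o : ℕ → V → ZMod d) (Ls : List (Layer G d)) (h : History V d) :
    h <+: recordAfter o Ls h := by
  induction Ls generalizing h with
  | nil => exact List.prefix_rfl
  | cons L Ls ih => exact (List.prefix_append _ _).trans (ih _)

variable [NeZero d]

theorem run_append (o : ℕ → V → ZMod d) (Ls Ls' : List (Layer G d)) (h : History V d)
    (ψ : State V d) :
    run o (Ls ++ Ls') h ψ = run o Ls' (recordAfter o Ls h) (run o Ls h ψ) := by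
  induction Ls generalizing h ψ with
  | nil => rfl
  | cons L Ls ih => exact ih _ _

theorem run_singleton (o : ℕ → V → ZMod d) (L : Layer G d) (h : History V d) (ψ : State V d) :
    run o [L] h ψ = L.apply h (o h.length) ψ := rfl

/-- The effect of a time step depends only on the outcomes which it records. -/
theorem Layer.apply_eq_of_record_eq (L : Layer G d) (h : History V d) {o o' : V → ZMod d}
    (ho : L.record o = L.record o') (ψ : State V d) : L.apply h o ψ = L.apply h o' ψ := by
  have hop : ∀ φ : State V d, ∀ op ∈ L.ops, op.apply h o φ = op.apply h o' φ := by
    intro φ op hmem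
    cases op with
    | measX q =>
      have hq := congrFun ho q
      simp only [Layer.record, hmem, true_or, if_true, Option.some.injEq] at hq
      simp only [Op.apply, hq]
    | measZ q =>
      have hq := congrFun ho q
      simp only [Layer.record, hmem, or_true, if_true, Option.some.injEq] at hq
      simp only [Op.apply, hq]
    | _ => rfl
  exact List.foldl_ext _ _ _ hop

/-- The final state depends only on the classical record. -/
theorem run_eq_of_recordAfter_eq {o o' : ℕ → V → ZMod d} (Ls : List (Layer G d)) (h : History V d)
    (ho : recordAfter o Ls h = recordAfter o' Ls h) (ψ : State V d) :
    run o Ls h ψ = run o' Ls h ψ := by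
  induction Ls generalizing h ψ with
  | nil => rfl
  | cons L Ls ih =>
    -- Both records after this step are initial segments, of equal length, of the same final record.
    have hrec : h ++ [L.record (o h.length)] = h ++ [L.record (o' h.length)] := by
      have h1 := prefix_recordAfter o Ls (h ++ [L.record (o h.length)])
      have h2 := prefix_recordAfter o' Ls (h ++ [L.record (o' h.length)])
      simp only [recordAfter] at ho
      rw [ho] at h1
      exact (List.prefix_of_prefix_length_le h1 h2 (by simp)).eq_of_length (by simp)
    have hL : L.record (o h.length) = L.record (o' h.length) := by simpa using hrec
    simp only [recordAfter, ← hrec] at ho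
    simp only [run, ← hrec, L.apply_eq_of_record_eq h hL]
    exact ih _ ho _

end Running

/-! ### Time steps of single-qudit operations -/

section SingleQudit

theorem foldl_projZ {V : Type*} {d : ℕ} (o : V → ZMod d) (l : List V) (ψ : State V d) (x : V → ZMod d) :
    l.foldl (fun φ v => projZ v (o v) φ) ψ x = if ∀ v ∈ l, x v = o v then ψ x else 0 := by
  induction l generalizing ψ with
  | nil => simp
  | cons v l ih =>
    rw [List.foldl_cons, ih]
    by_cases h : x v = o v <;> simp [projZ, h]

variable {V : Type*} [DecidableEq V] {d : ℕ} {G : Digraph V}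

theorem Op.support_measX (q : V) : (Op.measX q : Op G d).support = {q} := rfl

theorem Op.support_measZ (q : V) : (Op.measZ q : Op G d).support = {q} := rfl

theorem Op.support_gateX (q : V) (c : History V d → Bool) :
    (Op.gateX q c : Op G d).support = {q} := rfl

theorem Op.support_gateZ (q : V) (c : History V d → Bool) :
    (Op.gateZ q c : Op G d).support = {q} := rfl

/-- The time step which performs the operation `op v` on every qudit `v` in `s`. -/
noncomputable def Layer.onVertices (s : Finset V) (op : V → Op G d)
    (hop : ∀ v, (op v).support = {v}) : Layer G d where
  ops := s.toList.map op
  disjoint := by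
    refine List.Pairwise.map _ (fun a b hab => ?_) s.nodup_toList
    rw [hop, hop, Finset.disjoint_singleton]
    exact hab

variable [NeZero d]

theorem Layer.apply_onVertices (s : Finset V) (op : V → Op G d)
    (hop : ∀ v, (op v).support = {v}) (h : History V d) (o : V → ZMod d) (ψ : State V d) :
    (Layer.onVertices s op hop).apply h o ψ =
      s.toList.foldl (fun φ v => (op v).apply h o φ) ψ := by
  simp [Layer.apply, Layer.onVertices, List.foldl_map]

/-- The time step which measures the qudits of `s` in the eigenbasis of `Z_d`. -/
noncomputable def measZLayer (s : Finset V) : Layer G d :=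
  Layer.onVertices s Op.measZ Op.support_measZ

theorem apply_measZLayer (s : Finset V) (h : History V d) (o : V → ZMod d) (ψ : State V d)
    (x : V → ZMod d) :
    (measZLayer s : Layer G d).apply h o ψ x = if ∀ v ∈ s, x v = o v then ψ x else 0 := by
  rw [measZLayer, Layer.apply_onVertices]
  simpa [Op.apply] using foldl_projZ o s.toList ψ x

/-- The time step which measures the qudits of `s` in the eigenbasis of `X_d`. -/
noncomputable def measXLayer (s : Finset V) : Layer G d :=
  Layer.onVertices s Op.measX Op.support_measX

/-- The effect of measurements in the eigenbasis of `X_d` on a uniform superposition in which the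
measured qudits are functions of the qudits of a set `T`. -/
theorem foldl_projX [Fintype V] (o : V → ZMod d) (T : Set V)
    (z : (V → ZMod d) → V → ZMod d) (hz : ∀ x y, (∀ v ∈ T, x v = y v) → z x = z y) 
    (l : List V) (hl : l.Nodup) (hlT : ∀ v ∈ l, v ∉ T) (M : Finset V) (hM : ∀ v ∈ l, v ∉ M)
    (c : (V → ZMod d) → ℂ) (hc : ∀ x y, (∀ v ∈ T, x v = y v) → (∀ v ∈ M, x v = y v) → c x = c y)
    (ψ : State V d) (hψ : ∀ x, ψ x = if ∀ v ∉ M, x v = z x v then c x else 0) (x : V → ZMod d) :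
    l.foldl (fun φ v => projX v (o v) φ) ψ x =
      if ∀ v ∉ M ∪ l.toFinset, x v = z x v then
        c x * (l.map fun v => (d : ℂ)⁻¹ * ZMod.stdAddChar (-(o v * (x v - z x v)))).prod
      else 0 := by
  induction l generalizing M c ψ with
  | nil => simp [hψ]
  | cons q l ih =>
    have hqT : q ∉ T := hlT q (by simp)
    have hqM : q ∉ M := hM q (by simp)
    have hql : q ∉ l := (List.nodup_cons.1 hl).1
    -- The qudit `q` joins the set `M` of measured qudits, which are no longer tied to `z`, and its
    -- phase joins the amplitude `c`.
    rw [List.foldl_cons, ih (List.nodup_cons.1 hl).2 (fun v hv => hlT v (by simp [hv]))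
      (insert q M) (fun v hv => by
        rw [Finset.mem_insert, not_or]
        exact ⟨fun h => hql (h ▸ hv), hM v (by simp [hv])⟩)
      (fun x => c x * ((d : ℂ)⁻¹ * ZMod.stdAddChar (-(o q * (x q - z x q)))))]
    · have hset : insert q M ∪ l.toFinset = M ∪ (q :: l).toFinset := by
        ext v; simp
      rw [hset, List.map_cons, List.prod_cons, mul_assoc]
    · intro x y hT hM'
      rw [hc x y hT fun v hv => hM' v (Finset.mem_insert_of_mem hv), hz x y hT,
        hM' q (Finset.mem_insert_self _ _)]
    · intro x
      have hzu : ∀ a, z (Function.update x q a) = z x := fun a => hz _ _ fun v hv => by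
        rw [Function.update_of_ne]; rintro rfl; exact hqT hv
      have hcu : ∀ a, c (Function.update x q a) = c x := fun a => hc _ _
        (fun v hv => by rw [Function.update_of_ne]; rintro rfl; exact hqT hv)
        (fun v hv => by rw [Function.update_of_ne]; rintro rfl; exact hqM hv)
      -- In the sum that defines the projector, only the shift which brings `q` to its prescribed
      -- value `z x q` contributes.
      have hiff : ∀ k, (∀ v ∉ M, Function.update x q (x q - k) v = z x v) ↔
          k = x q - z x q ∧ ∀ v ∉ insert q M, x v = z x v := by
        intro k
        constructor
        · intro h
          refine ⟨?_, fun v hv => ?_⟩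
          · have := h q hqM
            rw [Function.update_self] at this
            rw [← this]; ring
          · rw [Finset.mem_insert, not_or] at hv
            simpa [Function.update_of_ne hv.1] using h v hv.2
        · rintro ⟨rfl, h⟩ v hv
          by_cases hvq : v = q
          · subst hvq; simp
          · rw [Function.update_of_ne hvq]
            exact h v (by simp [hvq, hv])
      simp only [projX, hψ, hzu, hcu, hiff]
      by_cases h : ∀ v ∉ insert q M, x v = z x v
      · rw [if_pos h]
        simp only [eq_true h, and_true, Finset.sum_ite_eq', mul_ite, mul_zero, Finset.mem_univ,
          if_true]
        ring
      · rw [if_neg h]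
        simp only [eq_false h, and_false, if_false, mul_zero, Finset.sum_const_zero]

/-- The effect of measurements in the eigenbasis of `X_d` on a uniform superposition in which the
measured qudits are functions of the qudits of a set `T`. -/
theorem apply_measXLayer [Fintype V] (s : Finset V) (h : History V d) (o : V → ZMod d)
    (T : Set V) (hsT : ∀ v ∈ s, v ∉ T)
    (z : (V → ZMod d) → V → ZMod d) (hz : ∀ x y, (∀ v ∈ T, x v = y v) → z x = z y) (K : ℂ)
    (ψ : State V d) (hψ : ∀ x, ψ x = if ∀ v, x v = z x v then K else 0) (x : V → ZMod d) :
    (measXLayer s : Layer G d).apply h o ψ x =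
      if ∀ v ∉ s, x v = z x v then
        K * ∏ v ∈ s, ((d : ℂ)⁻¹ * ZMod.stdAddChar (-(o v * (x v - z x v))))
      else 0 := by
  have := foldl_projX o T z hz s.toList s.nodup_toList (by simpa using hsT) ∅ (by simp)
    (fun _ => K) (fun _ _ _ _ => rfl) ψ (by simpa using hψ) x
  rw [measXLayer, Layer.apply_onVertices]
  simpa [Op.apply] using this

/-- Powers of single-qudit gates, with classically computed exponents, on all qudits. Here `act a`
is the product of the gates `gate v` to the powers `a v`. -/
theorem run_powers [Fintype V] (gate : V → (History V d → Bool) → Op G d)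
    (hgate : ∀ v c, (gate v c).support = {v}) (act : (V → ZMod d) → State V d → State V d)
    (act_zero : ∀ ψ, act 0 ψ = ψ) (act_add : ∀ a b ψ, act (a + b) ψ = act b (act a ψ))
    (act_single : ∀ v c h o ψ,
      (gate v c).apply h o ψ = if c h then act (Pi.single v 1) ψ else ψ)
    (e : History V d → V → ZMod d) (n : ℕ) (o : ℕ → V → ZMod d) (H : History V d)
    (hH : H.length = n) (h : History V d) (hHh : H <+: h) (ψ : State V d) :
    run o ((List.range (d - 1)).map fun j => Layer.onVertices Finset.univ
      (fun v => gate v fun h => decide (j < (e (h.take n) v).val)) fun _ => hgate _ _) h ψ =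
      act (e H) ψ := by
  have hfold : ∀ (c : V → Bool) (l : List V) (ψ : State V d),
      l.foldl (fun φ v => if c v then act (Pi.single v 1) φ else φ) ψ =
        act (l.map fun v => if c v then Pi.single v 1 else 0).sum ψ := by
    intro c l
    induction l with
    | nil => intro ψ; simp [act_zero]
    | cons v l ih =>
      intro ψ
      rw [List.foldl_cons, ih, List.map_cons, List.sum_cons, act_add]
      split_ifs <;> simp [act_zero]
  -- The exponents must be read from the record `H` at the start of the corrections; every later
  -- record extends it.
  have htake : ∀ h : History V d, H <+: h → h.take n = H := fun h hh => by
    rw [← hH]; exact (List.prefix_iff_eq_take.1 hh).symm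
  have hrun : ∀ (l : List ℕ) (h : History V d) (ψ : State V d), H <+: h →
      run o (l.map fun j => Layer.onVertices Finset.univ
        (fun v => gate v fun h => decide (j < (e (h.take n) v).val)) fun _ => hgate _ _) h ψ =
      act (l.map fun j => fun v => if j < (e H v).val then 1 else 0).sum ψ := by
    intro l
    induction l with
    | nil => intro h ψ _; simp [run, act_zero]
    | cons j l ih =>
      intro h ψ hh
      rw [List.map_cons, List.map_cons, run, ih _ _ (hh.trans (List.prefix_append _ _)),
        List.sum_cons, act_add, Layer.apply_onVertices]
      simp only [act_single, htake h hh]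
      rw [hfold]
      congr 2
      rw [Finset.sum_map_toList]
      funext v
      rw [Finset.sum_apply, Finset.sum_eq_single v]
      · by_cases hj : j < (e H v).val <;> simp [hj]
      · intro w _ hw
        by_cases hj : j < (e H w).val <;> simp [hj, hw.symm]
      · simp
  rw [hrun _ _ _ hHh]
  congr 1
  rw [← List.sum_toFinset _ (List.nodup_range), List.toFinset_range]
  funext v
  -- At `v` the gate is applied in the steps `j < (e H v).val`; the `d - 1` available steps suffice.
  have hlt : (e H v).val ≤ d - 1 := Nat.le_sub_one_of_lt (ZMod.val_lt _)
  rw [Finset.sum_apply, Finset.sum_boole]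
  have : (Finset.range (d - 1)).filter (fun j => j < (e H v).val) =
      Finset.range (e H v).val := by
    ext j; simp; omega
  rw [this, Finset.card_range, ZMod.natCast_zmod_val]

end SingleQudit

/-! ### Broadcasting messages by `Add` gates -/

section Shear

open Matrix

variable {V : Type*} [Fintype V] {d : ℕ}

/-- The linear map `|x⟩ ↦ |x + x A⟩`, for matrices `A` with `A ^ 2 = 0`. -/
def shear (A : Matrix V V (ZMod d)) (ψ : State V d) : State V d :=
  fun x => ψ (x - x ᵥ* A)

theorem shear_zero (ψ : State V d) : shear 0 ψ = ψ := by
  funext x; simp [shear]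

/-- The cross term is `x B A`, which vanishes when no target of `B` is a source of `A`. Hence
additions into one colour class simply accumulate. -/
theorem shear_shear (A B : Matrix V V (ZMod d)) (hBA : B * A = 0) (ψ : State V d) :
    shear B (shear A ψ) = shear (A + B) ψ := by
  funext x
  simp only [shear, sub_vecMul, vecMul_vecMul, hBA, vecMul_zero, sub_zero, vecMul_add]
  congr 1
  abel

/-- The product of two matrices with entries on edges into the colour class `k` vanishes. -/
theorem mul_eq_zero_of_colour {col : V → ℕ} {k : ℕ} {A B : Matrix V V (ZMod d)}
    (hA : ∀ u v, A u v ≠ 0 → col u ≠ k) (hB : ∀ u v, B u v ≠ 0 → col v = k) : B * A = 0 := by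
  ext u v
  rw [mul_apply, Matrix.zero_apply]
  refine Finset.sum_eq_zero fun w _ => ?_
  by_cases h : B u w = 0
  · rw [h, zero_mul]
  · have : A w v = 0 := by
      by_contra h'
      exact hA w v h' (hB u w h)
    rw [this, mul_zero]

theorem applyAdd_eq_shear [DecidableEq V] (u v : V) (ψ : State V d) :
    applyAdd u v ψ = shear (Matrix.single u v 1) ψ := by
  funext x
  refine congrArg ψ (funext fun w => ?_)
  by_cases h : w = v
  · subst h; simp [vecMul, dotProduct, Matrix.single_apply]
  · simp [vecMul, dotProduct, h, Ne.symm h]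

variable {G : Digraph V}

theorem foldl_applyAdd [DecidableEq V] {col : V → ℕ} {k : ℕ} (l : List (V × V))
    (hl : ∀ e ∈ l, col e.1 ≠ k ∧ col e.2 = k) (ψ : State V d) :
    l.foldl (fun φ e => applyAdd e.1 e.2 φ) ψ =
      shear (l.map fun e => Matrix.single e.1 e.2 (1 : ZMod d)).sum ψ := by
  induction l generalizing ψ with
  | nil => simp [shear_zero]
  | cons e l ih =>
    have hl' : ∀ e ∈ l, col e.1 ≠ k ∧ col e.2 = k := fun e he => hl e (by simp [he])
    rw [List.foldl_cons, ih hl', applyAdd_eq_shear, List.map_cons, List.sum_cons]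
    refine shear_shear _ _ (mul_eq_zero_of_colour (col := col) (k := k) ?_ ?_) ψ
    · intro u v h
      by_cases hu : e.1 = u
      · rw [← hu]; exact (hl e (by simp)).1
      · exact absurd (by simp [hu]) h
    · intro u v h
      by_contra hv
      refine h ?_
      clear ih h hl
      induction l with
      | nil => simp
      | cons a l ih =>
        rw [List.map_cons, List.sum_cons, Matrix.add_apply, ih fun e he => hl' e (by simp [he]),
          Matrix.single_apply, if_neg, add_zero]
        rintro ⟨-, rfl⟩
        exact hv (hl' a (by simp)).2

/-- The time step which performs the `Add` gates along the edges of a matching. -/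
noncomputable def addLayer [DecidableEq V] (hG : ∀ v, ¬ G.Adj v v)
    (E : Finset {e : V × V // G.Adj e.1 e.2})
    (hE : ∀ e ∈ E, ∀ e' ∈ E, e ≠ e' →
      Disjoint ({e.1.1, e.1.2} : Finset V) {e'.1.1, e'.1.2}) : Layer G d where
  ops := E.toList.map fun e => Op.add e.1.1 e.1.2 (fun h => hG _ (h ▸ e.2)) e.2
  disjoint := by
    rw [List.pairwise_map]
    exact E.nodup_toList.pairwise_of_forall_ne fun a ha b hb hab =>
      hE a (Finset.mem_toList.1 ha) b (Finset.mem_toList.1 hb) hab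

theorem run_shear [NeZero d] [DecidableEq V] {ι : Type*} {col : V → ℕ} {k : ℕ} (L : ι → Layer G d)
    (A : ι → Matrix V V (ZMod d)) (hA : ∀ i u v, A i u v ≠ 0 → col u ≠ k ∧ col v = k)
    (hL : ∀ i h o ψ, (L i).apply h o ψ = shear (A i) ψ) (l : List ι) (o : ℕ → V → ZMod d)
    (h : History V d) (ψ : State V d) :
    run o (l.map L) h ψ = shear (l.map A).sum ψ := by
  induction l generalizing h ψ with
  | nil => simp [run, shear_zero]
  | cons i l ih =>
    rw [List.map_cons, run, ih, hL, List.map_cons, List.sum_cons]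
    refine shear_shear _ _ (mul_eq_zero_of_colour (col := col) (k := k)
      (fun u v h => (hA i u v h).1) fun u v => ?_) ψ
    contrapose!
    intro hv
    clear ih
    induction l with
    | nil => simp
    | cons j l ih =>
      rw [List.map_cons, List.sum_cons, Matrix.add_apply, ih, add_zero]
      by_contra h
      exact hv (hA j u v h).2

/-- Let `A` be a matrix with entries on the edges of `G` which go to one colour class of a proper
colouring. All the multiples of messages in `A` can be sent in `δ (d - 1)` time steps. -/
theorem exists_layers_shear [NeZero d] [DecidableEq V] (hG : ∀ v, ¬ G.Adj v v) {col : V → ℕ}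
    (hcol : ∀ u v, G.Adj u v → col u ≠ col v) (k : ℕ) (A : Matrix V V (ZMod d))
    (hA : ∀ u v, A u v ≠ 0 → G.Adj u v ∧ col v = k) :
    ∃ Ls : List (Layer G d), Ls.length = maxInOutDegree G * (d - 1) ∧
      ∀ o h ψ, run o Ls h ψ = shear A ψ := by
  classical
  obtain ⟨π, hπ⟩ := exists_perms_cover_adj G
  choose! f hfδ hf using hπ
  -- Step `(i, j)` uses the edges of the `i`-th permutation whose coefficient exceeds `j`, so that
  -- an edge is used as often as its coefficient says.
  let E : ℕ × ℕ → Finset {e : V × V // G.Adj e.1 e.2} := fun p => Finset.univ.filter fun e =>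
    f e.1.1 e.1.2 = p.1 ∧ p.2 < (A e.1.1 e.1.2).val
  have hEcol : ∀ p, ∀ e ∈ E p, col e.1.1 ≠ k ∧ col e.1.2 = k := by
    intro p e he
    have hne : A e.1.1 e.1.2 ≠ 0 := by
      intro h0
      simp [E, h0] at he
    have h2 := (hA _ _ hne).2
    exact ⟨h2 ▸ hcol _ _ e.2, h2⟩
  have hE : ∀ p, ∀ e ∈ E p, ∀ e' ∈ E p, e ≠ e' →
      Disjoint ({e.1.1, e.1.2} : Finset V) {e'.1.1, e'.1.2} := by
    intro p e he e' he' hne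
    have h1 := hEcol p e he
    have h2 := hEcol p e' he'
    have hπe : π p.1 e.1.1 = e.1.2 := by
      rw [← (Finset.mem_filter.1 he).2.1]; exact hf _ _ e.2
    have hπe' : π p.1 e'.1.1 = e'.1.2 := by
      rw [← (Finset.mem_filter.1 he').2.1]; exact hf _ _ e'.2
    have h11 : e.1.1 ≠ e'.1.1 := fun h => hne <| Subtype.ext <| Prod.ext h (by
      rw [← hπe, ← hπe', h])
    have h22 : e.1.2 ≠ e'.1.2 := fun h => h11 <| (π p.1).injective (by rw [hπe, hπe', h])
    -- A permutation may contain paths of two edges; these are excluded because targets have colour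
    -- `k` and sources do not.
    have h12 : e.1.1 ≠ e'.1.2 := fun h => h1.1 (h ▸ h2.2)
    have h21 : e.1.2 ≠ e'.1.1 := fun h => h2.1 (h ▸ h1.2)
    simp [h11.symm, h22.symm, h12.symm, h21.symm]
  let B : ℕ × ℕ → Matrix V V (ZMod d) := fun p => Matrix.of fun u v =>
    if G.Adj u v ∧ f u v = p.1 ∧ p.2 < (A u v).val then 1 else 0
  have hB : ∀ p, ∑ e ∈ E p, Matrix.single e.1.1 e.1.2 (1 : ZMod d) = B p := by
    intro p
    ext u v
    rw [Matrix.sum_apply]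
    by_cases h : G.Adj u v ∧ f u v = p.1 ∧ p.2 < (A u v).val
    · rw [Finset.sum_eq_single ⟨(u, v), h.1⟩]
      · simp [B, h]
      · intro e _ he
        rw [Matrix.single_apply, if_neg]
        rintro ⟨rfl, rfl⟩
        exact he rfl
      · intro hn
        exact absurd (Finset.mem_filter.2 ⟨Finset.mem_univ (⟨(u, v), h.1⟩ : {e : V × V //
          G.Adj e.1 e.2}), h.2⟩) hn
    · simp only [B, Matrix.of_apply, if_neg h]
      refine Finset.sum_eq_zero fun e he => ?_
      rw [Matrix.single_apply, if_neg]
      rintro ⟨rfl, rfl⟩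
      exact h ⟨e.2, (Finset.mem_filter.1 he).2⟩
  refine ⟨(Finset.range (maxInOutDegree G) ×ˢ Finset.range (d - 1)).toList.map
    fun p => addLayer hG (E p) (hE p), by simp, fun o h ψ => ?_⟩
  rw [run_shear (col := col) (k := k) _ B ?_ ?_, Finset.sum_map_toList]
  · congr 1
    ext u v
    rw [Matrix.sum_apply, Finset.sum_product]
    simp only [Matrix.of_apply]
    by_cases h : G.Adj u v
    · rw [Finset.sum_eq_single (f u v)]
      · simp only [h, true_and, Finset.sum_boole]
        have hlt : (A u v).val ≤ d - 1 := Nat.le_sub_one_of_lt (ZMod.val_lt _)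
        have : (Finset.range (d - 1)).filter (fun j => j < (A u v).val) =
            Finset.range (A u v).val := by
          ext j; simp; omega
        rw [this, Finset.card_range, ZMod.natCast_zmod_val]
      · intro i _ hi
        simp [hi.symm]
      · intro hn
        exact absurd (Finset.mem_range.2 (hfδ u v h)) hn
    · have h0 : A u v = 0 := by
        by_contra h'
        exact h (hA u v h').1
      simp [h, h0]
  · intro p u v h
    have h' : G.Adj u v ∧ f u v = p.1 ∧ p.2 < (A u v).val := by
      by_contra hn
      exact h (if_neg hn)
    exact hEcol p ⟨(u, v), h'.1⟩ (Finset.mem_filter.2 ⟨Finset.mem_univ _, h'.2⟩)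
  · intro p h o ψ
    have h1 : (addLayer hG (E p) (hE p) : Layer G d).apply h o ψ =
        ((E p).toList.map Subtype.val).foldl (fun φ e => applyAdd e.1 e.2 φ) ψ := by
      simp [Layer.apply, addLayer, List.foldl_map, Op.apply]
    rw [h1, foldl_applyAdd (col := col) (k := k), List.map_map, ← hB]
    · congr 1
      exact Finset.sum_map_toList (E p) fun e => Matrix.single e.1.1 e.1.2 (1 : ZMod d)
    · intro e he
      obtain ⟨e', he', rfl⟩ := List.mem_map.1 he
      exact hEcol p e' (Finset.mem_toList.1 he')

end Shear

/-! ### Corrections which depend on the measurement outcomes -/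

section Corrections

open Matrix

variable {V : Type*} [Fintype V] [DecidableEq V] {d : ℕ} [NeZero d] {G : Digraph V}

/-- If, after the time steps `Ls`, a state with the property `good` can be reached by Pauli
operations which depend on the outcomes, then `2 (d - 1)` further time steps suffice for that. -/
theorem exists_corrections (Ls : List (Layer G d)) (ψ : State V d) (good : State V d → Prop)
    (hgood : ∀ o : ℕ → V → ZMod d, ∃ a b : V → ZMod d,
      good fun x => ZMod.stdAddChar (b ⬝ᵥ x) * run o Ls [] ψ (x - a)) :
    ∃ Ls' : List (Layer G d), Ls'.length = Ls.length + 2 * (d - 1) ∧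
      ∀ o, good (run o Ls' [] ψ) := by
  classical
  have key : ∃ a b : History V d → V → ZMod d, ∀ o, good fun x =>
      ZMod.stdAddChar (b (recordAfter o Ls []) ⬝ᵥ x) *
        run o Ls [] ψ (x - a (recordAfter o Ls [])) := by
    choose a b hab using hgood
    -- Corrections may depend on the record only, but `hgood` gives them for a full outcome
    -- function. Some outcome function with the same record is used instead; it leads to the same
    -- state.
    let g : History V d → ℕ → V → ZMod d := fun h =>
      if H : ∃ o, recordAfter o Ls [] = h then H.choose else 0
    have hg : ∀ o, recordAfter (g (recordAfter o Ls [])) Ls [] = recordAfter o Ls [] := by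
      intro o
      have H : ∃ o', recordAfter o' Ls [] = recordAfter o Ls [] := ⟨o, rfl⟩
      simp only [g, dif_pos H]
      exact H.choose_spec
    refine ⟨fun h => a (g h), fun h => b (g h), fun o => ?_⟩
    have := hab (g (recordAfter o Ls []))
    rwa [run_eq_of_recordAfter_eq Ls [] (hg o)] at this
  obtain ⟨a, b, hab⟩ := key
  refine ⟨Ls ++
    (((List.range (d - 1)).map fun j => Layer.onVertices Finset.univ
      (fun v => Op.gateX v fun h => decide (j < (a (h.take Ls.length) v).val))
      fun _ => Op.support_gateX _ _) ++
    ((List.range (d - 1)).map fun j => Layer.onVertices Finset.univ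
      (fun v => Op.gateZ v fun h => decide (j < (b (h.take Ls.length) v).val))
      fun _ => Op.support_gateZ _ _)), by simp; omega, fun o => ?_⟩
  have hlen : (recordAfter o Ls []).length = Ls.length := by simp [length_recordAfter]
  have hX := run_powers (G := G) (d := d) Op.gateX Op.support_gateX
    (fun a ψ x => ψ (x - a)) (by simp)
    (fun a b ψ => by funext x; simp only [add_comm a b, sub_sub])
    (fun v c h o ψ => by
      have : applyX v ψ = fun x => ψ (x - Pi.single v 1) := by
        funext x
        refine congrArg ψ (funext fun w => ?_)
        by_cases hw : w = v
        · subst hw; simp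
        · simp [hw]
      simp only [Op.apply, this])
    a Ls.length o (recordAfter o Ls []) hlen
  have hZ := run_powers (G := G) (d := d) Op.gateZ Op.support_gateZ
    (fun b ψ x => ZMod.stdAddChar (b ⬝ᵥ x) * ψ x) (by simp)
    (fun a b ψ => by
      funext x
      rw [add_dotProduct, AddChar.map_add_eq_mul]
      ring)
    (fun v c h o ψ => by
      have : applyZ v ψ = fun x => ZMod.stdAddChar (Pi.single v 1 ⬝ᵥ x) * ψ x := by
        funext x
        simp [applyZ]
      simp only [Op.apply, this])
    b Ls.length o (recordAfter o Ls []) hlen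
  rw [run_append, run_append, hX _ List.prefix_rfl, hZ _ (prefix_recordAfter _ _ _)]
  exact hab o

end Corrections

/-! ### Imposing the constraints of a linear code -/

section Constraints

open Matrix

/-- The state in which all qudits are prepared. -/
theorem exists_prep_amplitude {V : Type*} [Fintype V] (d : ℕ) (S : V → Prop)
    [DecidablePred S] : ∃ K : ℂ, ∀ x : V → ZMod d,
    ∏ v, (if S v then Prep.zero else Prep.plus).amplitude d (x v) =
      if ∀ v, S v → x v = 0 then K else 0 := by
  refine ⟨∏ v, if S v then 1 else ((√(d : ℝ) : ℝ) : ℂ)⁻¹, fun x => ?_⟩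
  have h : ∀ v, (if S v then Prep.zero else Prep.plus).amplitude d (x v) =
      if S v → x v = 0 then (if S v then 1 else ((√(d : ℝ) : ℝ) : ℂ)⁻¹) else 0 := fun v => by
    by_cases h : S v <;> simp [h, Prep.amplitude]
  simp only [h, Finset.prod_ite_zero, Finset.mem_univ, true_imp_iff]

variable {V : Type*} [Fintype V] [DecidableEq V] {d : ℕ}

/-- The matrix `A` with the columns outside `S` replaced by zero. -/
def onCols (S : Finset V) (A : Matrix V V (ZMod d)) : Matrix V V (ZMod d) :=
  Matrix.of fun u v => if v ∈ S then A u v else 0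

theorem vecMul_onCols (S : Finset V) (A : Matrix V V (ZMod d)) (x : V → ZMod d) (v : V) :
    (x ᵥ* onCols S A) v = if v ∈ S then (x ᵥ* A) v else 0 := by
  by_cases h : v ∈ S <;> simp [onCols, vecMul, dotProduct, h]

omit [DecidableEq V] in
theorem vecMul_apply_congr {A : Matrix V V (ZMod d)} {x y : V → ZMod d} {v : V}
    (h : ∀ u, A u v ≠ 0 → x u = y u) : (x ᵥ* A) v = (y ᵥ* A) v := by
  refine Finset.sum_congr rfl fun u _ => ?_
  by_cases hu : A u v = 0
  · simp [hu]
  · rw [h u hu]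

/-- The nodes outside `T` of colour `k`, except those in `W`. -/
def colourClass (T W : Finset V) (col : V → ℕ) (k : ℕ) : Finset V :=
  Finset.univ.filter fun v => v ∉ T ∧ v ∉ W ∧ col v = k

/-- The values `y` satisfy the affine constraints with the matrix `A` and the offsets `s` at all
nodes outside `T` of colour at most `k`, and vanish at the nodes of `W` of higher colours. -/
def Satisfies (T W : Finset V) (col : V → ℕ) (A : Matrix V V (ZMod d)) (s : V → ZMod d) (k : ℕ)
    (y : V → ZMod d) : Prop :=
  ∀ v ∉ T, (col v ≤ k → y v - (y ᵥ* A) v = s v) ∧ (v ∈ W → k < col v → y v = 0)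

variable {T W : Finset V} {col : V → ℕ} {A : Matrix V V (ZMod d)}

theorem mem_colourClass {k : ℕ} {v : V} :
    v ∈ colourClass T W col k ↔ v ∉ T ∧ v ∉ W ∧ col v = k := by
  simp [colourClass]

theorem onCols_mul_onCols (hcol : ∀ u v, A u v ≠ 0 → col u ≠ col v) (k : ℕ) :
    onCols (colourClass T W col k) A * onCols (colourClass T W col k) A = 0 := by
  refine mul_eq_zero_of_colour (col := col) (k := k) (fun u v h => ?_) fun u v h => ?_
  · simp only [onCols, Matrix.of_apply, ne_eq, ite_eq_right_iff, Classical.not_imp] at h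
    rw [← (mem_colourClass.1 h.1).2.2]
    exact hcol u v h.2
  · simp only [onCols, Matrix.of_apply, ne_eq, ite_eq_right_iff, Classical.not_imp] at h
    exact (mem_colourClass.1 h.1).2.2

omit [DecidableEq V] in
theorem sub_add_vecMul_self {B : Matrix V V (ZMod d)} (hB : B * B = 0) (x : V → ZMod d) :
    x - x ᵥ* B + (x - x ᵥ* B) ᵥ* B = x := by
  rw [sub_vecMul, vecMul_vecMul, hB, vecMul_zero, sub_zero, sub_add_cancel]

/-- The constraints of the colour `k + 1` are added by measuring the differences of the two sides. -/
theorem satisfies_succ_iff (hcol : ∀ u v, A u v ≠ 0 → col u ≠ col v)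
    (hWA : ∀ u ∈ W, ∀ v, A u v = 0) (s s' c : V → ZMod d) (k : ℕ)
    (hs : ∀ v, s' v = if col v = k + 1 then if v ∈ W then 0 else c v else s v) (x : V → ZMod d) :
    ((∀ v ∈ colourClass T W col (k + 1), x v = c v) ∧
      Satisfies T W col A s k
        (x - x ᵥ* (onCols (W.filter fun v => col v = k + 1) A -
          onCols (colourClass T W col (k + 1)) A))) ↔
    Satisfies T W col A s' (k + 1) (x + x ᵥ* onCols (colourClass T W col (k + 1)) A) := by
  -- Here `y` has the colour `k + 1` restored, and `z` is the configuration before the additions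
  -- into this colour. They differ only at nodes of `W`, which send nothing, so both send the same
  -- messages.
  set y := x + x ᵥ* onCols (colourClass T W col (k + 1)) A with hy
  set z := x - x ᵥ* (onCols (W.filter fun v => col v = k + 1) A -
    onCols (colourClass T W col (k + 1)) A) with hz
  have hyv : ∀ v, y v = x v + if v ∈ colourClass T W col (k + 1) then (x ᵥ* A) v else 0 :=
    fun v => by rw [hy, Pi.add_apply, vecMul_onCols]
  have hzv : ∀ v, z v = y v - if v ∈ W ∧ col v = k + 1 then (x ᵥ* A) v else 0 := fun v => by
    rw [hz, hyv, Pi.sub_apply, vecMul_sub, Pi.sub_apply, vecMul_onCols, vecMul_onCols]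
    simp only [Finset.mem_filter]
    ring
  have hzA : ∀ v, (z ᵥ* A) v = (y ᵥ* A) v := fun v => vecMul_apply_congr fun u hu => by
    rw [hzv, if_neg, sub_zero]
    exact fun h => hu (hWA u h.1 v)
  have hxA : ∀ v, col v = k + 1 → (x ᵥ* A) v = (y ᵥ* A) v := fun v hv =>
    vecMul_apply_congr fun u hu => by
      rw [hyv, if_neg, add_zero]
      exact fun h => hcol u v hu ((mem_colourClass.1 h).2.2.trans hv.symm)
  have key : ∀ v ∉ T, ((v ∈ colourClass T W col (k + 1) → x v = c v) ∧
      (col v ≤ k → z v - (z ᵥ* A) v = s v) ∧ (v ∈ W → k < col v → z v = 0)) ↔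
      ((col v ≤ k + 1 → y v - (y ᵥ* A) v = s' v) ∧ (v ∈ W → k + 1 < col v → y v = 0)) := by
    -- At colour `k + 1`, the condition `z v = 0` in `W` turns into a constraint with offset `0`,
    -- and the outcome `x v = c v` elsewhere into one with offset `c v`. Other colours are
    -- unaffected.
    intro v hvT
    rw [hzA, hzv, hs]
    by_cases hk : col v = k + 1
    · have hyx := hyv v
      simp only [hxA v hk, mem_colourClass] at hyx
      simp only [hxA v hk, mem_colourClass]
      by_cases hW : v ∈ W
      · simp [hk, hW]
      · simp only [hvT, not_false_eq_true, hW, hk, and_true, if_true] at hyx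
        simp [hk, hW, hvT, hyx]
    · have h1 : col v ≤ k + 1 ↔ col v ≤ k := by omega
      have h2 : k < col v ↔ k + 1 < col v := by omega
      simp [mem_colourClass, hk, h1, h2]
  constructor
  · rintro ⟨h1, h2⟩ v hv
    exact (key v hv).1 ⟨h1 v, h2 v hv⟩
  · intro h
    exact ⟨fun v hv => ((key v (mem_colourClass.1 hv).1).2 (h v (mem_colourClass.1 hv).1)).1 hv,
      fun v hv => ((key v hv).2 (h v hv)).2⟩

/-- Initially all nodes of colour `0` outside `T` and all nodes of `W` have the value `0`. -/
theorem satisfies_zero_iff (hcol : ∀ u v, A u v ≠ 0 → col u ≠ col v)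
    (hW0 : ∀ v ∈ W, col v ≠ 0) (x : V → ZMod d) :
    Satisfies T W col A 0 0 (x + x ᵥ* onCols (colourClass T W col 0) A) ↔
      ∀ v, v ∉ T ∧ (v ∈ W ∨ col v = 0) → x v = 0 := by
  set y := x + x ᵥ* onCols (colourClass T W col 0) A with hy
  have hyv : ∀ v, y v = x v + if v ∈ colourClass T W col 0 then (x ᵥ* A) v else 0 :=
    fun v => by rw [hy, Pi.add_apply, vecMul_onCols]
  have hxA : ∀ v, col v = 0 → (x ᵥ* A) v = (y ᵥ* A) v := fun v hv =>
    vecMul_apply_congr fun u hu => by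
      rw [hyv, if_neg, add_zero]
      exact fun h => hcol u v hu ((mem_colourClass.1 h).2.2.trans hv.symm)
  have key : ∀ v ∉ T, ((col v ≤ 0 → y v - (y ᵥ* A) v = (0 : V → ZMod d) v) ∧
      (v ∈ W → 0 < col v → y v = 0)) ↔ ((v ∈ W ∨ col v = 0) → x v = 0) := by
    intro v hvT
    simp only [hyv, mem_colourClass]
    by_cases h0 : col v = 0
    · have hW : v ∉ W := fun h => hW0 v h h0
      simp [h0, hW, hvT, hxA v h0]
    · simp [h0, Nat.pos_of_ne_zero h0]
  exact ⟨fun h v hv => (key v hv.1).1 (h v hv.1) hv.2, fun h v hv => (key v hv).2 fun h' =>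
    h v ⟨hv, h'⟩⟩

/-- After all the constraints have been imposed, all values are affine functions of the values
at the nodes of `T`. Here `N` is an inverse of `y ↦ y - y A`. -/
theorem satisfies_iff_eq {m : ℕ} (hm : ∀ v, col v ≤ m) (hcol : ∀ u v, A u v ≠ 0 → col u ≠ col v)
    (hTA : ∀ v ∈ T, ∀ u, A u v = 0) (N : (V → ZMod d) → V → ZMod d)
    (hN : ∀ y, N (y - y ᵥ* A) = y) (hN' : ∀ w, N w - N w ᵥ* A = w) (s x : V → ZMod d) :
    Satisfies T W col A s m (x + x ᵥ* onCols (colourClass T W col m) A) ↔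
      ∀ v, x v = (N (fun v => if v ∈ T then x v else s v) -
        N (fun v => if v ∈ T then x v else s v) ᵥ* onCols (colourClass T W col m) A) v := by
  set B := onCols (colourClass T W col m) A with hB
  set w : V → ZMod d := fun v => if v ∈ T then x v else s v with hw
  have hBB : B * B = 0 := onCols_mul_onCols hcol m
  have hsat : ∀ y : V → ZMod d, Satisfies T W col A s m y ↔
      ∀ v ∉ T, y v - (y ᵥ* A) v = s v := fun y =>
    forall₂_congr fun v _ => by simp [hm v, Nat.not_lt.2 (hm v)]
  have hTv : ∀ (y : V → ZMod d), ∀ v ∈ T, (y ᵥ* A) v = 0 := fun y v hv => by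
    simp [vecMul, dotProduct, hTA v hv]
  have hTB : ∀ (y : V → ZMod d), ∀ v ∈ T, (y ᵥ* B) v = 0 := fun y v hv => by
    rw [hB, vecMul_onCols, hTv y v hv, ite_self]
  rw [hsat, ← funext_iff]
  constructor
  · intro h
    have hy : (x + x ᵥ* B) - (x + x ᵥ* B) ᵥ* A = w := by
      funext v
      by_cases hv : v ∈ T
      · simp [hw, hv, hTv _ v hv, hTB _ v hv]
      · simpa [hw, hv] using h v hv
    rw [← hy, hN, add_vecMul, vecMul_vecMul, hBB, vecMul_zero, add_zero, add_sub_cancel_right]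
  · intro h v hv
    -- Since `B * B = 0`, the maps `x ↦ x + x B` and `y ↦ y - y B` are inverse to each other.
    have hy : x + x ᵥ* B = N w := by
      have h2 : x ᵥ* B = N w ᵥ* B := by
        rw [h, sub_vecMul, vecMul_vecMul, hBB, vecMul_zero, sub_zero]
      rw [h2]
      nth_rewrite 1 [h]
      rw [sub_add_cancel]
    rw [hy, ← Pi.sub_apply, hN']
    simp [hw, hv]

omit [DecidableEq V] in
/-- If the non-zero entries of `A` form no directed cycle, then `y ↦ y - y A` is invertible. -/
theorem exists_linear_inverse [Fact d.Prime]
    (hA : ∀ v, ¬ Relation.TransGen (fun u w => A u w ≠ 0) v v) :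
    ∃ N : (V → ZMod d) →ₗ[ZMod d] (V → ZMod d), (∀ y, N (y - y ᵥ* A) = y) ∧
      ∀ w, N w - N w ᵥ* A = w := by
  let Φ : (V → ZMod d) →ₗ[ZMod d] (V → ZMod d) := LinearMap.id - A.vecMulLinear
  have hΦ : ∀ y, Φ y = y - y ᵥ* A := fun y => rfl
  have hinj : Function.Injective Φ := by
    rw [← LinearMap.ker_eq_bot, LinearMap.ker_eq_bot']
    intro y hy
    -- A kernel vector is, at each node, a combination of its values at predecessors; it vanishes by
    -- induction along the acyclic relation.
    have hirr : Std.Irrefl (Relation.TransGen fun u w => A u w ≠ 0) := ⟨hA⟩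
    have hwf := Finite.wellFounded_of_trans_of_irrefl (Relation.TransGen fun u w => A u w ≠ 0)
    funext v
    induction v using hwf.induction with
    | _ v ih =>
      have h := congrFun hy v
      rw [hΦ, Pi.sub_apply, vecMul_apply_congr (y := 0) fun u hu =>
        ih u (Relation.TransGen.single hu)] at h
      simpa using h
  let N := LinearEquiv.ofInjectiveEndo Φ hinj
  exact ⟨N.symm.toLinearMap, fun y => N.symm_apply_apply y, fun w => N.apply_symm_apply w⟩

variable [NeZero d] {G : Digraph V}

open Classical in
/-- The constraints of all colours up to `k` can be imposed in `k (2 δ (d - 1) + 1)` time steps, up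
to replacing the values at the nodes of colour `k` by differences. -/
theorem exists_layers_satisfies (hG : ∀ v, ¬ G.Adj v v)
    (hcolG : ∀ u v, G.Adj u v → col u ≠ col v) (hA : ∀ u v, A u v ≠ 0 → G.Adj u v)
    (hW0 : ∀ v ∈ W, col v ≠ 0) (hWA : ∀ u ∈ W, ∀ v, A u v = 0)
    (K : ℂ) (ψ : State V d)
    (hψ : ∀ x, ψ x = if ∀ v, v ∉ T ∧ (v ∈ W ∨ col v = 0) → x v = 0 then K else 0) (k : ℕ) :
    ∃ Ls : List (Layer G d), Ls.length = k * (2 * (maxInOutDegree G * (d - 1)) + 1) ∧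
      ∀ o : ℕ → V → ZMod d, ∃ s : V → ZMod d, ∀ x, run o Ls [] ψ x =
        if Satisfies T W col A s k (x + x ᵥ* onCols (colourClass T W col k) A) then K else 0 := by
  have hcol : ∀ u v, A u v ≠ 0 → col u ≠ col v := fun u v h => hcolG u v (hA u v h)
  induction k with
  | zero =>
    refine ⟨[], by simp, fun o => ⟨0, fun x => ?_⟩⟩
    simp only [satisfies_zero_iff hcol hW0]
    exact hψ x
  | succ k ih =>
    obtain ⟨Ls, hlen, hLs⟩ := ih
    have hon : ∀ (S : Finset V) (j : ℕ), (∀ v ∈ S, col v = j) → ∀ u v, onCols S A u v ≠ 0 →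
        G.Adj u v ∧ col v = j := by
      intro S j hS u v h
      simp only [onCols, Matrix.of_apply, ne_eq, ite_eq_right_iff, Classical.not_imp] at h
      exact ⟨hA u v h.2, hS v h.1⟩
    -- `L₁` restores the values at colour `k`. `L₂` then adds incoming combinations at the nodes of
    -- `W` of colour `k + 1` and subtracts them at the nodes about to be measured.
    obtain ⟨L₁, hlen₁, hL₁⟩ := exists_layers_shear hG hcolG k _
      (hon (colourClass T W col k) k fun v hv => (mem_colourClass.1 hv).2.2)
    obtain ⟨L₂, hlen₂, hL₂⟩ := exists_layers_shear hG hcolG (k + 1)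
      (onCols (W.filter fun v => col v = k + 1) A - onCols (colourClass T W col (k + 1)) A)
      (fun u v h => by
        by_cases h1 : onCols (W.filter fun v => col v = k + 1) A u v = 0
        · refine hon (colourClass T W col (k + 1)) (k + 1)
            (fun v hv => (mem_colourClass.1 hv).2.2) u v fun h2 => h ?_
          rw [Matrix.sub_apply, h1, h2, sub_zero]
        · exact hon _ (k + 1) (fun v hv => (Finset.mem_filter.1 hv).2) u v h1)
    refine ⟨Ls ++ (L₁ ++ (L₂ ++ [measZLayer (colourClass T W col (k + 1))])), ?_, fun o => ?_⟩
    · simp only [List.length_append, hlen, hlen₁, hlen₂, List.length_singleton]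
      ring
    · obtain ⟨s, hs⟩ := hLs o
      simp only [run_append, run_singleton, hL₁, hL₂, apply_measZLayer]
      set c := o (recordAfter o L₂ (recordAfter o L₁ (recordAfter o Ls []))).length
      refine ⟨fun v => if col v = k + 1 then if v ∈ W then 0 else c v else s v, fun x => ?_⟩
      simp only [← satisfies_succ_iff hcol hWA s _ c k (fun _ => rfl) x]
      by_cases hc : ∀ v ∈ colourClass T W col (k + 1), x v = c v
      · simp only [eq_true hc, true_and, if_true]
        rw [shear, shear, hs, sub_add_vecMul_self (onCols_mul_onCols hcol k)]
      · simp only [eq_false hc, false_and, if_false]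

end Constraints

/-! ### Distributing entanglement -/

section Distribution

open Matrix

variable {V : Type*} [DecidableEq V] {d : ℕ} [NeZero d]

theorem ghz_insert (t : V) (R : Finset V) (x : V → ZMod d) :
    ghz (insert t R) x = if ∀ r ∈ R, x r = x t then ((√(d : ℝ) : ℝ) : ℂ)⁻¹ else 0 := by
  have h : ∑ a : ZMod d, ∏ q ∈ insert t R, (if x q = a then (1 : ℂ) else 0) =
      if ∀ r ∈ R, x r = x t then 1 else 0 := by
    simp only [Finset.prod_ite_zero, Finset.prod_const_one, Finset.forall_mem_insert]
    rw [Finset.sum_eq_single (x t)]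
    · simp
    · intro a _ ha
      rw [if_neg]
      exact fun h => ha h.1.symm
    · simp
  rw [ghz, h]
  split_ifs <;> simp

theorem prod_ghz {G : Digraph V} {N : ℕ} (P : Multicast G N) (x : V → ZMod d) :
    ∏ j, ghz (P.party j) x =
      if ∀ j, ∀ r ∈ P.R j, x r = x (P.t j) then (((√(d : ℝ) : ℝ) : ℂ)⁻¹) ^ N else 0 := by
  simp only [Multicast.party, ghz_insert, Finset.prod_ite_zero, Finset.prod_const,
    Finset.mem_univ, true_imp_iff, Finset.card_univ, Fintype.card_fin]

theorem addChar_sum {ι A M : Type*} [AddCommMonoid A] [CommMonoid M] (χ : AddChar A M)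
    (s : Finset ι) (f : ι → A) : χ (∑ i ∈ s, f i) = ∏ i ∈ s, χ (f i) := by
  classical
  induction s using Finset.induction_on with
  | empty => simp
  | insert i s hi ih => rw [Finset.sum_insert hi, Finset.prod_insert hi, AddChar.map_add_eq_mul, ih]

theorem sqrt_natCast_ne_zero : ((√(d : ℝ) : ℝ) : ℂ) ≠ 0 := by
  rw [Ne, Complex.ofReal_eq_zero, Real.sqrt_eq_zero (Nat.cast_nonneg d), Nat.cast_eq_zero]
  exact NeZero.ne d

variable [Fintype V] {G : Digraph V} {N : ℕ}

omit [NeZero d] in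
/-- Every linear functional on `ZMod d`-vectors is the product with a vector. -/
theorem exists_dotProduct_eq (L : (V → ZMod d) →ₗ[ZMod d] ZMod d) :
    ∃ b : V → ZMod d, ∀ x, b ⬝ᵥ x = L x :=
  ⟨fun v => L (Pi.single v 1), fun x => by
    rw [LinearMap.pi_apply_eq_sum_univ L x, dotProduct]
    refine Finset.sum_congr rfl fun v _ => ?_
    rw [smul_eq_mul, mul_comm]
    congr 2
    funext w
    simp [Pi.single_apply, eq_comm]⟩

open Classical in
/-- A uniform superposition over an affine space, in which the receivers hold the values of their
transmitters up to constants, can be corrected to `GHZ` states once the remaining qudits have been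
measured in the eigenbasis of `X_d`. -/
theorem exists_corrections_after_measX (P : Multicast G N)
    (ℓ : (V → ZMod d) →ₗ[ZMod d] (V → ZMod d)) (c : V → ZMod d)
    (hℓ : ∀ x y : V → ZMod d, (∀ j, x (P.t j) = y (P.t j)) → ℓ x = ℓ y)
    (ht : ∀ x j, ℓ x (P.t j) + c (P.t j) = x (P.t j))
    (hr : ∀ x j, ∀ r ∈ P.R j, ℓ x r = x (P.t j))
    (K : ℂ) (ψ : State V d) (hψ : ∀ x, ψ x = if ∀ v, x v = ℓ x v + c v then K else 0)
    (h : History V d) (o : V → ZMod d) :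
    ∃ a b : V → ZMod d, ∃ φ : ({q : V // ∀ j, q ∉ P.party j} → ZMod d) → ℂ, ∀ x : V → ZMod d,
      ZMod.stdAddChar (b ⬝ᵥ x) *
        (measXLayer (Finset.univ.filter fun q => ∀ j, q ∉ P.party j) : Layer G d).apply h o ψ
          (x - a) =
      (∏ j, ghz (P.party j) x) * φ fun q => x q := by
  set Q : Finset V := Finset.univ.filter fun q => ∀ j, q ∉ P.party j with hQ
  have hQt : ∀ j, P.t j ∉ Q := fun j hj => (Finset.mem_filter.1 hj).2 j (Finset.mem_insert_self _ _)
  have hQr : ∀ j, ∀ r ∈ P.R j, r ∉ Q := fun j r hr hj =>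
    (Finset.mem_filter.1 hj).2 j (Finset.mem_insert_of_mem hr)
  -- The shift cancels the constants at the receivers.
  let a : V → ZMod d := fun v => if ∃ j, v ∈ P.R j then -c v else 0
  have hat : ∀ j, a (P.t j) = 0 := fun j => if_neg fun ⟨i, hi⟩ => P.t_notMem_R j i hi
  have har : ∀ j, ∀ r ∈ P.R j, a r = -c r := fun j r hr => if_pos ⟨j, hr⟩
  have haQ : ∀ q ∈ Q, a q = 0 := fun q hq => if_neg fun ⟨j, hj⟩ => hQr j q hj hq
  -- The X measurements leave the phase `∑ q ∈ Q, o q * ℓ x q` and factors depending only on the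
  -- measured qudits; `b` cancels the former, and `φ` collects the latter.
  obtain ⟨b, hb⟩ := exists_dotProduct_eq (-∑ q ∈ Q, o q • LinearMap.proj q ∘ₗ ℓ)
  refine ⟨a, b, fun y => ((√(d : ℝ) : ℝ) : ℂ) ^ N * (K * ∏ q ∈ Q, ((d : ℂ)⁻¹ *
    ZMod.stdAddChar (-(o q * ((if hq : ∀ j, q ∉ P.party j then y ⟨q, hq⟩ else 0) - c q))))),
    fun x => ?_⟩
  rw [apply_measXLayer Q h o (Set.range P.t) (fun v hv ⟨j, hj⟩ => hQt j (hj ▸ hv))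
    (fun x => ℓ x + c) (fun x y hxy => by rw [hℓ x y fun j => hxy _ ⟨j, rfl⟩]) K ψ hψ, prod_ghz]
  have hℓa : ℓ (x - a) = ℓ x := hℓ _ _ fun j => by rw [Pi.sub_apply, hat, sub_zero]
  have hiff : (∀ v ∉ Q, (x - a) v = (ℓ (x - a) + c) v) ↔
      ∀ j, ∀ r ∈ P.R j, x r = x (P.t j) := by
    rw [hℓa]
    constructor
    · intro H j r hrj
      have := H r (hQr j r hrj)
      rw [Pi.sub_apply, Pi.add_apply, har j r hrj, hr x j r hrj] at this
      simpa using this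
    · intro H v hv
      obtain ⟨j, hj⟩ : ∃ j, v ∈ P.party j := by simpa [hQ] using hv
      rcases Finset.mem_insert.1 hj with rfl | hj
      · rw [Pi.sub_apply, Pi.add_apply, ht, hat, sub_zero]
      · rw [Pi.sub_apply, Pi.add_apply, har j v hj, hr x j v hj, H j v hj, sub_neg_eq_add]
  by_cases H : ∀ j, ∀ r ∈ P.R j, x r = x (P.t j)
  · rw [if_pos (hiff.2 H), if_pos H, hb, hℓa]
    have hprod : ∏ q ∈ Q, ((d : ℂ)⁻¹ * ZMod.stdAddChar (-(o q * ((x - a) q - (ℓ x + c) q)))) =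
        ZMod.stdAddChar (∑ q ∈ Q, o q * ℓ x q) * ∏ q ∈ Q, ((d : ℂ)⁻¹ *
          ZMod.stdAddChar (-(o q * ((if hq : ∀ j, q ∉ P.party j then x q else 0) - c q)))) := by
      rw [addChar_sum, ← Finset.prod_mul_distrib]
      refine Finset.prod_congr rfl fun q hq => ?_
      rw [dif_pos (Finset.mem_filter.1 hq).2, Pi.sub_apply, Pi.add_apply, haQ q hq,
        mul_left_comm, ← AddChar.map_add_eq_mul]
      congr 2
      ring
    rw [hprod]
    have hneg : (-∑ q ∈ Q, o q • LinearMap.proj q ∘ₗ ℓ) x = -∑ q ∈ Q, o q * ℓ x q := by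
      simp [LinearMap.sum_apply]
    have h1 : ZMod.stdAddChar (-∑ q ∈ Q, o q * ℓ x q) *
        ZMod.stdAddChar (∑ q ∈ Q, o q * ℓ x q) = 1 := by
      rw [← AddChar.map_add_eq_mul, neg_add_cancel, AddChar.map_zero_eq_one]
    have h2 : (((√(d : ℝ) : ℝ) : ℂ)⁻¹) ^ N * ((√(d : ℝ) : ℝ) : ℂ) ^ N = 1 := by
      rw [← mul_pow, inv_mul_cancel₀ sqrt_natCast_ne_zero, one_pow]
    rw [hneg]
    linear_combination (K * ∏ q ∈ Q, ((d : ℂ)⁻¹ * ZMod.stdAddChar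
      (-(o q * ((if hq : ∀ j, q ∉ P.party j then x q else 0) - c q))))) * (h1 - h2)
  · rw [if_neg (fun h => H (hiff.1 h)), if_neg H, mul_zero, zero_mul]

end Distribution

/-! ### Assembling the circuit -/

section Main

open Matrix

variable {V : Type*} [Fintype V] [DecidableEq V] {d : ℕ} [Fact d.Prime] {G : Digraph V} {N : ℕ}

/-- If no two nodes are adjacent, then there are no receivers, and the preparation suffices. -/
theorem exists_circuit_of_not_adj (P : Multicast G N) (C : LinearCode P d)
    (hG : ∀ u v, ¬ G.Adj u v) : ∃ Q : Circuit G d, Q.Distributes P ∧ Q.depth = 1 := by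
  refine ⟨⟨fun _ => Prep.plus, []⟩, fun o => ?_, rfl⟩
  have hR : ∀ j, P.R j = ∅ := by
    intro j
    rw [Finset.eq_empty_iff_forall_notMem]
    intro r hr
    -- A receiver without incoming edges computes `0`, even when all inputs are `1`.
    have h := C.msg_other 1 r fun ⟨i, hi⟩ => P.t_notMem_R i j (hi ▸ hr)
    rw [C.msg_receiver 1 j r hr, Finset.sum_eq_zero] at h
    · exact one_ne_zero h
    · intro u _
      have : C.coeff u r = 0 := by
        by_contra h
        exact hG u r (C.adj_of_coeff_ne_zero u r h)
      rw [this, zero_mul]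
  refine ⟨fun _ => ((√(d : ℝ) : ℝ) : ℂ) ^ N * (((√(d : ℝ) : ℝ) : ℂ)⁻¹) ^ Fintype.card V,
    fun x => ?_⟩
  rw [prod_ghz, if_pos (by simp [hR]), ← mul_assoc, ← mul_pow,
    inv_mul_cancel₀ sqrt_natCast_ne_zero, one_pow, one_mul]
  simp [Circuit.final, run, Prep.amplitude]

open Classical in
/-- The circuit for a proper colouring with the colours `0, …, m + 1`. -/
theorem exists_circuit_of_colouring (P : Multicast G N) (C : LinearCode P d)
    (hG : ∀ v, ¬ G.Adj v v) {col : V → ℕ} (hcolG : ∀ u v, G.Adj u v → col u ≠ col v) (m : ℕ)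
    (hm : ∀ v, col v ≤ m + 1) :
    ∃ Q : Circuit G d, Q.Distributes P ∧
      Q.depth = (m + 1) * (2 * (maxInOutDegree G * (d - 1)) + 1) + 2 * (d - 1) + 2 := by
  set A : Matrix V V (ZMod d) := Matrix.of C.coeff with hA
  set T : Finset V := Finset.univ.image P.t with hT
  -- Receivers of colour 0 need no special treatment: they are restored in the first round, which
  -- exists as there are at least two colours.
  set W : Finset V := Finset.univ.filter fun v => (∃ j, v ∈ P.R j) ∧ col v ≠ 0 with hW
  have hAG : ∀ u v, A u v ≠ 0 → G.Adj u v := C.adj_of_coeff_ne_zero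
  have hmemT : ∀ v, v ∈ T ↔ ∃ j, P.t j = v := fun v => by simp [hT]
  have hTA : ∀ v ∈ T, ∀ u, A u v = 0 := by
    intro v hv u
    obtain ⟨j, rfl⟩ := (hmemT v).1 hv
    by_contra h
    exact P.t_in_degree j u (hAG _ _ h)
  have hWA : ∀ u ∈ W, ∀ v, A u v = 0 := by
    intro u hu v
    obtain ⟨j, hj⟩ := (Finset.mem_filter.1 hu).2.1
    by_contra h
    exact P.R_out_degree j u hj v (hAG _ _ h)
  obtain ⟨K, hK⟩ := exists_prep_amplitude d fun v : V => v ∉ T ∧ (v ∈ W ∨ col v = 0)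
  obtain ⟨Ls, hlen, hLs⟩ := exists_layers_satisfies (T := T) (W := W) hG hcolG hAG
    (fun v hv => (Finset.mem_filter.1 hv).2.2) hWA K _ hK (m + 1)
  obtain ⟨M, hM, hM'⟩ := exists_linear_inverse (A := A) C.acyclic
  set B := onCols (colourClass T W col (m + 1)) A with hB
  obtain ⟨res, hres⟩ : ∃ res : (V → ZMod d) →ₗ[ZMod d] (V → ZMod d),
      ∀ x v, res x v = if v ∈ T then x v else 0 :=
    ⟨LinearMap.pi fun v => if v ∈ T then LinearMap.proj v else 0, fun x v => by
      by_cases h : v ∈ T <;> simp [h]⟩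
  obtain ⟨E, hE⟩ : ∃ E : (V → ZMod d) →ₗ[ZMod d] (V → ZMod d), ∀ w, E w = M w - M w ᵥ* B :=
    ⟨(LinearMap.id - B.vecMulLinear) ∘ₗ M, fun w => rfl⟩
  have hEB : ∀ w v, v ∉ colourClass T W col (m + 1) → E w v = M w v := fun w v hv => by
    rw [hE, Pi.sub_apply, hB, vecMul_onCols, if_neg hv, sub_zero]
  set ψ : State V d := fun x =>
    ∏ v, (if v ∉ T ∧ (v ∈ W ∨ col v = 0) then Prep.zero else Prep.plus).amplitude d (x v) with hψ
  set Q : Finset V := Finset.univ.filter fun q => ∀ j, q ∉ P.party j with hQ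
  have hgood : ∀ o : ℕ → V → ZMod d, ∃ a b : V → ZMod d,
      ∃ φ : ({q : V // ∀ j, q ∉ P.party j} → ZMod d) → ℂ, ∀ x : V → ZMod d,
        ZMod.stdAddChar (b ⬝ᵥ x) * run o (Ls ++ [measXLayer Q]) [] ψ (x - a) =
          (∏ j, ghz (P.party j) x) * φ fun q => x q := by
    intro o
    obtain ⟨s, hs⟩ := hLs o
    simp only [run_append, run_singleton]
    refine exists_corrections_after_measX P (E ∘ₗ res) (E fun v => if v ∈ T then 0 else s v)
      ?_ ?_ ?_ K _ ?_ _ _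
    · intro x y hxy
      have : res x = res y := by
        funext v
        rw [hres, hres]
        split_ifs with h
        · obtain ⟨j, rfl⟩ := (hmemT v).1 h
          exact hxy j
        · rfl
      rw [LinearMap.comp_apply, LinearMap.comp_apply, this]
    · intro x j
      have hj : P.t j ∈ T := (hmemT _).2 ⟨j, rfl⟩
      have hjc : P.t j ∉ colourClass T W col (m + 1) := fun h => (mem_colourClass.1 h).1 hj
      have hMt : ∀ w, M w (P.t j) = w (P.t j) := fun w => by
        have h0 : (M w ᵥ* A) (P.t j) = 0 := by simp [vecMul, dotProduct, hTA _ hj]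
        have := congrFun (hM' w) (P.t j)
        rwa [Pi.sub_apply, h0, sub_zero] at this
      rw [LinearMap.comp_apply, hEB _ _ hjc, hEB _ _ hjc, hMt, hMt, hres, if_pos hj, if_pos hj,
        add_zero]
    · intro x j r hr
      -- A receiver of the last colour `m + 1 ≠ 0` lies in `W`, so no receiver is left unrestored.
      have hrc : r ∉ colourClass T W col (m + 1) := fun h => by
        obtain ⟨-, h2, h3⟩ := mem_colourClass.1 h
        exact h2 (Finset.mem_filter.2 ⟨Finset.mem_univ _, ⟨j, hr⟩, by omega⟩)
      -- The messages solve the constraints with zero offsets, which identifies the linear part of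
      -- the solution at the receivers.
      have hmsg : C.msg (fun j => x (P.t j)) - C.msg (fun j => x (P.t j)) ᵥ* A = res x := by
        funext v
        rw [Pi.sub_apply, hres]
        by_cases hv : v ∈ T
        · have h0 : (C.msg (fun j => x (P.t j)) ᵥ* A) v = 0 := by
            simp [vecMul, dotProduct, hTA _ hv]
          obtain ⟨i, rfl⟩ := (hmemT v).1 hv
          rw [h0, C.msg_transmitter, if_pos hv, sub_zero]
        · rw [if_neg hv, sub_eq_zero, C.msg_other _ v fun h => hv ((hmemT v).2 h)]
          exact Finset.sum_congr rfl fun u _ => mul_comm _ _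
      rw [LinearMap.comp_apply, hEB _ _ hrc, ← hmsg, hM, C.msg_receiver _ j r hr]
    · intro x
      have hw : (fun v => if v ∈ T then x v else s v) =
          res x + fun v => if v ∈ T then 0 else s v := by
        funext v
        rw [Pi.add_apply, hres]
        split_ifs <;> simp
      have h := satisfies_iff_eq (T := T) (W := W) hm (fun u v h => hcolG u v (hAG u v h)) hTA M
        hM hM' s x
      rw [hs]
      refine if_congr (h.trans (forall_congr' fun v => ?_)) rfl rfl
      rw [← hB, ← hE, hw, map_add, Pi.add_apply, LinearMap.comp_apply]
  obtain ⟨Ls', hlen', hLs'⟩ := exists_corrections (Ls ++ [measXLayer Q]) ψ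
    (fun ψ => ∃ φ : ({q : V // ∀ j, q ∉ P.party j} → ZMod d) → ℂ,
      ∀ x, ψ x = (∏ j, ghz (P.party j) x) * φ fun q => x q) hgood
  refine ⟨⟨fun v => if v ∉ T ∧ (v ∈ W ∨ col v = 0) then Prep.zero else Prep.plus, Ls'⟩,
    hLs', ?_⟩
  rw [Circuit.depth, hlen', List.length_append, hlen, List.length_singleton]
  ring

end Main

end QLNC

theorem mainTheorem4 {d : ℕ} [Fact d.Prime] {V : Type*} [Fintype V] [DecidableEq V] [Nonempty V]
    (G : Digraph V) (hG : ∀ v, ¬ G.Adj v v) {N : ℕ} (P : QLNC.Multicast G N)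
    (hcode : Nonempty (QLNC.LinearCode P d))
    (χ : ℕ) (hχ : G.toSimpleGraphInclusive.chromaticNumber = (χ : ℕ∞)) :
    ∃ Q : QLNC.Circuit G d, Q.Distributes P ∧
      (Q.depth : ℤ) ≤
        2 * ((d : ℤ) - 1) * (((QLNC.maxInOutDegree G : ℤ) + 2) * ((χ : ℤ) - 1) + 1) := by
  obtain ⟨C⟩ := hcode
  obtain ⟨c⟩ := SimpleGraph.chromaticNumber_le_iff_colorable.1 hχ.le
  have hcol : ∀ u v, G.Adj u v → (c u : ℕ) ≠ c v := fun u v h => Fin.val_injective.ne <|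
    c.valid ⟨fun huv => hG v (huv ▸ h), Or.inl h⟩
  obtain ⟨e, rfl⟩ : ∃ e, d = e + 2 := Nat.exists_eq_add_of_le' (Fact.out : d.Prime).two_le
  match χ, c, hcol with
  | 0, c, _ => exact (c (Classical.arbitrary V)).elim0
  -- The bound is now `2 (d - 1)`, which leaves no room for preparation and X measurement besides
  -- full corrections.
  | 1, c, hcol =>
    obtain ⟨Q, hQ, hdepth⟩ := QLNC.exists_circuit_of_not_adj P C fun u v h =>
      hcol u v h (by rw [Subsingleton.elim (c u) (c v)])
    refine ⟨Q, hQ, ?_⟩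
    rw [hdepth]
    push_cast
    linarith [Int.natCast_nonneg e]
  | m + 2, c, hcol =>
    obtain ⟨Q, hQ, hdepth⟩ := QLNC.exists_circuit_of_colouring P C hG hcol m
      fun v => Nat.lt_succ_iff.1 (c v).2
    refine ⟨Q, hQ, ?_⟩
    rw [hdepth, show e + 2 - 1 = e + 1 from rfl]
    push_cast
    -- With `d = e + 2` and `χ = m + 2`, the slack is `4em + 4e + 3m + 1`.
    nlinarith [mul_nonneg (Int.natCast_nonneg e) (Int.natCast_nonneg m), Int.natCast_nonneg e,
      Int.natCast_nonneg m]
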